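/- Let $0<\alpha<1$, $m,y_0\in\mathbb{R}$, $K>0$, $b>0$, put $G=\{(t,y): t\in[0,b],\ |y-y_0|\le K\}$, and let $f:[0,b]\to\mathbb{R}$ be such that $z(t,y)=my+f(t)$ is continuous on $G$. Let $M=\sup_{(t,y)\in G}|z(t,y)|$, and let $B=b$ if $M=0$ and $B=\min\{b,(K\,\Gamma(\alpha+1)/M)^{1/\alpha}\}$ otherwise. For a continuous function $y$ on $[0,B]$ define the Caputo derivative $$D^\alpha_*y(t)=\frac{d}{dt}\left(\frac{1}{\Gamma(1-\alpha)}\int_0^t (t-s)^{-\alpha}\,(y(s)-y(0))\,ds\right),\qquad 0\le t\le B,$$ whenever this derivative exists (one-sided at $t=0$ and $t=B$). Then there is exactly one function $y\in C[0,B]$ for which $D^\alpha_*y(t)$ exists and $$D^\alpha_*y(t)=m\,y(t)+f(t)\quad\text{for all } t\in[0,B],\qquad y(0)=y_0.$$ Moreover, the graph of this solution lies in $G$, that is, $|y(t)-y_0|\le K$ for all $t\in[0,B]$; uniqueness holds among all functions in $C[0,B]$, not only among those with graph in $G$. -/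

import Mathlib

open Set

/-- The Riemann--Liouville fractional integral `J^α_a g (t) = Γ(α)⁻¹ ∫_a^t (t - s)^(α-1) g(s) ds`
of order `α > 0` with starting point `a`. -/
noncomputable def rlIntegral (α a : ℝ) (g : ℝ → ℝ) (t : ℝ) : ℝ :=
  1 / Real.Gamma α * ∫ s in a..t, (t - s) ^ (α - 1) * g s

/-- For `0 < α < 1` (so that `⌈α⌉ = 1`): the Riemann--Liouville derivative
`D^α_a g = D J^(1-α)_a g` of `g`, as a function on the interval `[a, c]`, exists at `t`
and equals `d`. At the end points of `[a, c]` the derivative is one-sided. -/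
def HasRLDerivAt (α a c : ℝ) (g : ℝ → ℝ) (d t : ℝ) : Prop :=
  HasDerivWithinAt (rlIntegral (1 - α) a g) d (Icc a c) t

/-- For `0 < α < 1`: the Caputo derivative `D^α_{*a} g = D^α_a (g - T₀[g; a])` of `g`, as a
function on `[a, c]`, exists at `t` and equals `d`. The Taylor polynomial `T₀[g; a]` of degree
`⌈α⌉ - 1 = 0` is the constant `g a`. -/
def HasCaputoDerivAt (α a c : ℝ) (g : ℝ → ℝ) (d t : ℝ) : Prop :=
  HasRLDerivAt α a c (fun s => g s - g a) d t

/-- `y` is an element of `C[0, B]` that solves the initial value problem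
`D^α_* y(t) = m y(t) + f(t)` for `0 ≤ t ≤ B`, `y(0) = y₀`.
Only the values of `y` and `f` on `[0, B]` matter. -/
structure IsCaputoSolution (α m : ℝ) (f : ℝ → ℝ) (y₀ B : ℝ) (y : ℝ → ℝ) : Prop where
  continuousOn : ContinuousOn y (Icc 0 B)
  initial : y 0 = y₀
  equation : ∀ t ∈ Icc 0 B, HasCaputoDerivAt α 0 B y (m * y t + f t) t

/-- The set `G = {(t, y) : t ∈ [0, b], |y - y₀| ≤ K}`. -/
def solutionBox (b K y₀ : ℝ) : Set (ℝ × ℝ) :=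
  {p | p.1 ∈ Icc 0 b ∧ |p.2 - y₀| ≤ K}

/-- `M = sup_{(t, y) ∈ G} |m y + f(t)|`. -/
noncomputable def rhsSup (m : ℝ) (f : ℝ → ℝ) (b K y₀ : ℝ) : ℝ :=
  sSup ((fun p : ℝ × ℝ => |m * p.2 + f p.1|) '' solutionBox b K y₀)

open Classical in
/-- `B = b` if `M = 0`, and `B = min {b, (K Γ(α+1) / M)^(1/α)}` otherwise. -/
noncomputable def existenceTime (α m : ℝ) (f : ℝ → ℝ) (b K y₀ : ℝ) : ℝ :=
  if rhsSup m f b K y₀ = 0 then b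
  else min b ((K * Real.Gamma (α + 1) / rhsSup m f b K y₀) ^ (1 / α))

open MeasureTheory Filter Topology

/-! Everything rests on `J^(1-α) J^α g = ∫ g` (`rlIntegral_rlIntegral`) and on the weight `e^(lt)`,
for which `J^α` has norm at most `l^(-α)` (`rlIntegral_exp_le`); a large `l` makes `m J^α` a
contraction by 1/2 on an interval of any length.

Existence: the Volterra equation `y = y₀ + J^α (m y + f)` is solved by Banach's theorem. The choice
of `B` only serves to keep the iteration in `|y - y₀| ≤ K`, through `|J^α z| ≤ M t^α / Γ(α+1)`.
Applying `J^(1-α)` and differentiating gives the Caputo equation.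

Uniqueness: for the difference `d` of two solutions, `J^(1-α) d` has derivative `m d` and vanishes
at 0, so it equals `m D` with `D = ∫ d`. Applying `J^α` gives `D = m J^α D`, so `D = 0` by the
weighted estimate, and `d = D' = 0`. No bound on the solutions enters. -/

/-! ### Basic calculus and bounds for the fractional integral -/

theorem intervalIntegrable_sub_rpow {α : ℝ} (hα : 0 < α) (c a b : ℝ) :
    IntervalIntegrable (fun s => (c - s) ^ (α - 1)) volume a b := by
  have h := (intervalIntegral.intervalIntegrable_rpow' (a := c - a) (b := c - b)
    (show -1 < α - 1 by linarith)).comp_sub_left c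
  simpa using h

theorem intervalIntegrable_rlKernel_mul {α t : ℝ} (hα : 0 < α) (ht : 0 ≤ t) {g : ℝ → ℝ}
    (hg : ContinuousOn g (Icc 0 t)) :
    IntervalIntegrable (fun s => (t - s) ^ (α - 1) * g s) volume 0 t :=
  (intervalIntegrable_sub_rpow hα t 0 t).mul_continuousOn (by rwa [uIcc_of_le ht])

theorem integral_sub_rpow {α : ℝ} (hα : 0 < α) (t : ℝ) :
    ∫ s in (0 : ℝ)..t, (t - s) ^ (α - 1) = t ^ α / α := by
  rw [intervalIntegral.integral_comp_sub_left (fun x => x ^ (α - 1)) t,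
    integral_rpow (Or.inl (by linarith))]
  simp [Real.zero_rpow hα.ne']

theorem rlIntegral_zero_right (α : ℝ) (g : ℝ → ℝ) : rlIntegral α 0 g 0 = 0 := by
  simp [rlIntegral]

theorem rlIntegral_congr {α t : ℝ} (ht : 0 ≤ t) {g h : ℝ → ℝ} (hgh : EqOn g h (Icc 0 t)) :
    rlIntegral α 0 g t = rlIntegral α 0 h t := by
  unfold rlIntegral
  congr 1
  refine intervalIntegral.integral_congr fun s hs => ?_
  rw [uIcc_of_le ht] at hs
  simp only [hgh hs]

theorem rlIntegral_sub {α t : ℝ} (hα : 0 < α) (ht : 0 ≤ t) {g h : ℝ → ℝ}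
    (hg : ContinuousOn g (Icc 0 t)) (hh : ContinuousOn h (Icc 0 t)) :
    rlIntegral α 0 (fun s => g s - h s) t = rlIntegral α 0 g t - rlIntegral α 0 h t := by
  simp only [rlIntegral, mul_sub]
  rw [intervalIntegral.integral_sub (intervalIntegrable_rlKernel_mul hα ht hg)
    (intervalIntegrable_rlKernel_mul hα ht hh), mul_sub]

theorem rlIntegral_const_mul (α t c : ℝ) (g : ℝ → ℝ) :
    rlIntegral α 0 (fun s => c * g s) t = c * rlIntegral α 0 g t := by
  simp only [rlIntegral, mul_left_comm _ c]
  rw [intervalIntegral.integral_const_mul]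
  ring

theorem abs_rlIntegral_le {α t : ℝ} (hα : 0 < α) (ht : 0 ≤ t) {g h : ℝ → ℝ}
    (hh : ContinuousOn h (Icc 0 t)) (hgh : ∀ s ∈ Icc 0 t, |g s| ≤ h s) :
    |rlIntegral α 0 g t| ≤ rlIntegral α 0 h t := by
  have hΓ : 0 < 1 / Real.Gamma α := one_div_pos.2 (Real.Gamma_pos_of_pos hα)
  unfold rlIntegral
  rw [abs_mul, abs_of_pos hΓ]
  refine mul_le_mul_of_nonneg_left ?_ hΓ.le
  rw [← Real.norm_eq_abs]
  refine intervalIntegral.norm_integral_le_of_norm_le ht (ae_of_all _ fun s hs => ?_)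
    (intervalIntegrable_rlKernel_mul hα ht hh)
  have h0 : 0 ≤ (t - s) ^ (α - 1) := Real.rpow_nonneg (by linarith [hs.2]) _
  rw [Real.norm_eq_abs, abs_mul, abs_of_nonneg h0]
  exact mul_le_mul_of_nonneg_left (hgh s (Ioc_subset_Icc_self hs)) h0

theorem rlIntegral_const {α : ℝ} (hα : 0 < α) (t c : ℝ) :
    rlIntegral α 0 (fun _ => c) t = c * (t ^ α / Real.Gamma (α + 1)) := by
  unfold rlIntegral
  rw [intervalIntegral.integral_mul_const, integral_sub_rpow hα, Real.Gamma_add_one hα.ne']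
  have := (Real.Gamma_pos_of_pos hα).ne'
  field_simp

/-- Substituting `u = t - s` pulls out `e^(lt)`; enlarging the remaining integral to the half-line
turns it into a Gamma integral. -/
theorem rlIntegral_exp_le {α l t : ℝ} (hα : 0 < α) (hl : 0 < l) (ht : 0 ≤ t) :
    rlIntegral α 0 (fun s => Real.exp (l * s)) t ≤ (1 / l) ^ α * Real.exp (l * t) := by
  have hΓ : 0 < Real.Gamma α := Real.Gamma_pos_of_pos hα
  have h1 : ∫ s in (0 : ℝ)..t, (t - s) ^ (α - 1) * Real.exp (l * s)
      = Real.exp (l * t) * ∫ u in Ioc 0 t, u ^ (α - 1) * Real.exp (-(l * u)) := by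
    have := intervalIntegral.integral_comp_sub_left (a := 0) (b := t)
      (fun u => Real.exp (l * t) * (u ^ (α - 1) * Real.exp (-(l * u)))) t
    rw [sub_self, sub_zero] at this
    rw [← intervalIntegral.integral_of_le ht, ← intervalIntegral.integral_const_mul, ← this]
    refine intervalIntegral.integral_congr fun s _ => ?_
    rw [mul_left_comm, ← Real.exp_add]
    ring_nf
  -- Otherwise the integral would have the default value 0, against its positive closed form.
  have hint : IntegrableOn (fun u : ℝ => u ^ (α - 1) * Real.exp (-(l * u))) (Ioi 0) := by
    by_contra hn
    have := Real.integral_rpow_mul_exp_neg_mul_Ioi hα hl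
    rw [integral_undef hn] at this
    have : 0 < (1 / l) ^ α * Real.Gamma α := by positivity
    linarith
  have h2 : ∫ u in Ioc 0 t, u ^ (α - 1) * Real.exp (-(l * u)) ≤ (1 / l) ^ α * Real.Gamma α := by
    rw [← Real.integral_rpow_mul_exp_neg_mul_Ioi hα hl]
    refine setIntegral_mono_set hint ?_ Ioc_subset_Ioi_self.eventuallyLE
    filter_upwards [ae_restrict_mem measurableSet_Ioi] with u hu
    exact mul_nonneg (Real.rpow_nonneg (le_of_lt hu) _) (Real.exp_pos _).le
  unfold rlIntegral
  rw [h1]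
  calc 1 / Real.Gamma α * (Real.exp (l * t) *
        ∫ u in Ioc 0 t, u ^ (α - 1) * Real.exp (-(l * u)))
      ≤ 1 / Real.Gamma α * (Real.exp (l * t) * ((1 / l) ^ α * Real.Gamma α)) := by gcongr
    _ = (1 / l) ^ α * Real.exp (l * t) := by field_simp

/-! ### Continuity of the fractional integral -/

/-- The scaling `s = t x` frees the limits and the singular kernel of `t`, so that continuity in `t`
follows by dominated convergence. -/
theorem rlIntegral_eq_rpow_mul_integral (α : ℝ) {t : ℝ} (ht : 0 ≤ t) (hα : 0 < α) (g : ℝ → ℝ) :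
    rlIntegral α 0 g t =
      1 / Real.Gamma α * (t ^ α * ∫ x in (0 : ℝ)..1, (1 - x) ^ (α - 1) * g (t * x)) := by
  rcases ht.eq_or_lt with rfl | h
  · simp [rlIntegral, Real.zero_rpow hα.ne']
  unfold rlIntegral
  congr 1
  have := intervalIntegral.mul_integral_comp_mul_left (a := 0) (b := 1)
    (f := fun s => (t - s) ^ (α - 1) * g s) t
  rw [mul_zero, mul_one] at this
  rw [← this, ← intervalIntegral.integral_const_mul, ← intervalIntegral.integral_const_mul]
  refine intervalIntegral.integral_congr fun x hx => ?_
  rw [uIcc_of_le zero_le_one] at hx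
  rw [show t - t * x = t * (1 - x) by ring, Real.mul_rpow ht (by linarith [hx.2]),
    Real.rpow_sub_one h.ne']
  field_simp

theorem exists_continuous_bounded_eqOn_Icc {a b : ℝ} (hab : a ≤ b) {g : ℝ → ℝ}
    (hg : ContinuousOn g (Icc a b)) :
    ∃ G : ℝ → ℝ, Continuous G ∧ (∃ C, ∀ s, ‖G s‖ ≤ C) ∧ EqOn g G (Icc a b) := by
  obtain ⟨C, hC⟩ := isCompact_Icc.exists_bound_of_continuousOn hg
  refine ⟨fun s => g (projIcc a b hab s), ?_, ⟨C, fun s => hC _ (projIcc a b hab s).2⟩,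
    fun s hs => ?_⟩
  · exact hg.comp_continuous (continuous_subtype_val.comp continuous_projIcc)
      fun s => (projIcc a b hab s).2
  · simp only [projIcc_of_mem hab hs]

theorem continuousOn_rlIntegral {α B : ℝ} (hα : 0 < α) (hB : 0 ≤ B) {g : ℝ → ℝ}
    (hg : ContinuousOn g (Icc 0 B)) : ContinuousOn (rlIntegral α 0 g) (Icc 0 B) := by
  obtain ⟨G, hGc, ⟨C, hGC⟩, hgG⟩ := exists_continuous_bounded_eqOn_Icc hB hg
  have hcont : Continuous fun t : ℝ =>
      1 / Real.Gamma α * (t ^ α * ∫ x in (0 : ℝ)..1, (1 - x) ^ (α - 1) * G (t * x)) := by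
    refine continuous_const.mul ((Real.continuous_rpow_const hα.le).mul ?_)
    refine intervalIntegral.continuous_of_dominated_interval
      (bound := fun x => ‖(1 - x) ^ (α - 1)‖ * C) (fun t => ?_) (fun t => ?_) ?_ ?_
    · have h := (intervalIntegrable_sub_rpow hα 1 0 1).mul_continuousOn
        (hGc.comp (continuous_const_mul t)).continuousOn
      exact h.def'.aestronglyMeasurable
    · refine ae_of_all _ fun x _ => ?_
      rw [norm_mul]
      exact mul_le_mul_of_nonneg_left (hGC _) (norm_nonneg _)
    · exact (intervalIntegrable_sub_rpow hα 1 0 1).norm.mul_const C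
    · exact ae_of_all _ fun x _ => continuous_const.mul (hGc.comp (continuous_mul_const x))
  refine hcont.continuousOn.congr fun t ht => ?_
  rw [rlIntegral_congr ht.1 (hgG.mono (Icc_subset_Icc_right ht.2)),
    rlIntegral_eq_rpow_mul_integral α ht.1 hα]

/-! ### Semigroup law for orders summing to 1 -/

/-- A scaled Beta integral: the power of `t - r` is `α + β - 1 = 0`, and `Γ(α + β) = 1`. -/
theorem integral_rlKernel_mul_rlKernel {α β r t : ℝ} (hα : 0 < α) (hβ : 0 < β)
    (hαβ : α + β = 1) (hrt : r < t) :
    ∫ s in r..t, (t - s) ^ (β - 1) * (s - r) ^ (α - 1) = Real.Gamma α * Real.Gamma β := by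
  have h1 := Complex.betaIntegral_scaled α β (sub_pos.2 hrt)
  have h2 := Complex.Gamma_mul_Gamma_eq_betaIntegral (s := α) (t := β) (by simpa) (by simpa)
  have h3 : (α : ℂ) + β = 1 := by exact_mod_cast hαβ
  rw [h3, Complex.Gamma_one, one_mul] at h2
  rw [h3, sub_self, Complex.cpow_zero, one_mul, ← h2, Complex.Gamma_ofReal,
    Complex.Gamma_ofReal] at h1
  have h4 := intervalIntegral.integral_comp_sub_right (a := r) (b := t)
    (fun x => x ^ (α - 1) * (t - r - x) ^ (β - 1)) r
  rw [sub_self] at h4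
  have h5 : ∫ s in r..t, (t - s) ^ (β - 1) * (s - r) ^ (α - 1)
      = ∫ x in (0 : ℝ)..(t - r), x ^ (α - 1) * (t - r - x) ^ (β - 1) := by
    rw [← h4]
    refine intervalIntegral.integral_congr fun s _ => ?_
    rw [mul_comm, sub_sub_sub_cancel_right]
  rw [h5, ← Complex.ofReal_inj, ← intervalIntegral.integral_ofReal, Complex.ofReal_mul, ← h1]
  refine intervalIntegral.integral_congr fun x hx => ?_
  rw [uIcc_of_le (sub_pos.2 hrt).le] at hx
  rw [Complex.ofReal_mul, Complex.ofReal_cpow hx.1, Complex.ofReal_cpow (by linarith [hx.2])]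
  push_cast
  rfl

/-- Fubini on the triangle `r < s`: after the swap, the inner integral is the constant `Γ(α) Γ(β)`.
-/
theorem rlIntegral_rlIntegral {α β t : ℝ} (hα : 0 < α) (hβ : 0 < β) (hαβ : α + β = 1)
    (ht : 0 ≤ t) {g : ℝ → ℝ} (hg : ContinuousOn g (Icc 0 t)) :
    rlIntegral β 0 (rlIntegral α 0 g) t = ∫ s in (0 : ℝ)..t, g s := by
  set μ : Measure ℝ := volume.restrict (Ioc 0 t) with hμ
  -- Truncation turns the triangle into a square, on which Fubini applies to a product measure.
  set k : ℝ → ℝ → ℝ := fun s r => if r < s then (s - r) ^ (α - 1) else 0 with hk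
  have hkm : Measurable (fun p : ℝ × ℝ => (t - p.1) ^ (β - 1) * k p.1 p.2) := by
    refine Measurable.mul (by fun_prop) (Measurable.ite ?_ (by fun_prop) measurable_const)
    exact measurableSet_lt measurable_snd measurable_fst
  have hind : ∀ (s : ℝ) (φ : ℝ → ℝ), (fun r => k s r * φ r)
      = (Iio s).indicator fun r => (s - r) ^ (α - 1) * φ r := by
    intro s φ
    ext r
    by_cases h : r < s <;> simp [hk, h]
  have hset : ∀ s ∈ Ioc 0 t, Iio s ∩ Ioc 0 t = Ioo 0 s := by
    intro s hs
    ext r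
    simp only [mem_inter_iff, mem_Iio, mem_Ioc, mem_Ioo]
    exact ⟨fun h => ⟨h.2.1, h.1⟩, fun h => ⟨h.2, h.1, h.2.le.trans hs.2⟩⟩
  have hinner : ∀ s ∈ Ioc 0 t, ∀ φ : ℝ → ℝ,
      ∫ r, k s r * φ r ∂μ = ∫ r in (0 : ℝ)..s, (s - r) ^ (α - 1) * φ r := by
    intro s hs φ
    rw [hind, integral_indicator measurableSet_Iio, hμ, Measure.restrict_restrict measurableSet_Iio,
      hset s hs, intervalIntegral.integral_of_le hs.1.le, integral_Ioc_eq_integral_Ioo]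
  have hinner_int : ∀ s ∈ Ioc 0 t, Integrable (fun r => k s r) μ := by
    intro s hs
    have := hind s (fun _ => 1)
    simp only [mul_one] at this
    rw [this, integrable_indicator_iff measurableSet_Iio, IntegrableOn, hμ,
      Measure.restrict_restrict measurableSet_Iio, hset s hs, ← IntegrableOn,
      ← integrableOn_Ioc_iff_integrableOn_Ioo, ← intervalIntegrable_iff_integrableOn_Ioc_of_le hs.1.le]
    exact intervalIntegrable_sub_rpow hα s 0 s
  have hk0 : ∀ s r, 0 ≤ k s r := by
    intro s r
    simp only [hk]
    split_ifs with h
    · exact Real.rpow_nonneg (by linarith) _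
    · exact le_rfl
  have hK : Integrable (fun p : ℝ × ℝ => (t - p.1) ^ (β - 1) * k p.1 p.2) (μ.prod μ) := by
    rw [integrable_prod_iff hkm.aestronglyMeasurable]
    constructor
    · filter_upwards [ae_restrict_mem measurableSet_Ioc] with s hs
      exact (hinner_int s hs).const_mul _
    · have h1 : IntervalIntegrable (fun s : ℝ => (t - s) ^ (β - 1) * (s ^ α / α)) volume 0 t :=
        intervalIntegrable_rlKernel_mul hβ ht
          ((Real.continuous_rpow_const hα.le).div_const α).continuousOn
      rw [intervalIntegrable_iff_integrableOn_Ioc_of_le ht] at h1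
      refine h1.congr ?_
      filter_upwards [ae_restrict_mem measurableSet_Ioc] with s hs
      have h0 : 0 ≤ (t - s) ^ (β - 1) := Real.rpow_nonneg (by linarith [hs.2]) _
      have h2 := hinner s hs (fun _ => 1)
      simp only [mul_one] at h2
      simp only [norm_mul, Real.norm_of_nonneg h0, Real.norm_of_nonneg (hk0 _ _)]
      rw [integral_const_mul, h2, integral_sub_rpow hα]
  obtain ⟨C, hC⟩ := isCompact_Icc.exists_bound_of_continuousOn hg
  have hgm : AEStronglyMeasurable g μ :=
    (hg.mono Ioc_subset_Icc_self).aestronglyMeasurable measurableSet_Ioc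
  have hKg : Integrable (fun p : ℝ × ℝ => (t - p.1) ^ (β - 1) * k p.1 p.2 * g p.2)
      (μ.prod μ) := by
    refine hK.mul_bdd (c := C) hgm.comp_snd ?_
    have : ∀ᵐ r ∂μ, ‖g r‖ ≤ C := by
      filter_upwards [ae_restrict_mem measurableSet_Ioc] with r hr
      exact hC r (Ioc_subset_Icc_self hr)
    exact Measure.quasiMeasurePreserving_snd.ae this
  have hswap := integral_integral_swap
    (f := fun s r => (t - s) ^ (β - 1) * k s r * g r) hKg
  have hleft : ∫ s, ∫ r, (t - s) ^ (β - 1) * k s r * g r ∂μ ∂μ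
      = ∫ s in (0 : ℝ)..t, (t - s) ^ (β - 1) * ∫ r in (0 : ℝ)..s, (s - r) ^ (α - 1) * g r := by
    rw [intervalIntegral.integral_of_le ht]
    refine setIntegral_congr_fun measurableSet_Ioc fun s hs => ?_
    simp only [mul_assoc]
    rw [integral_const_mul, hinner s hs]
  have hright : ∫ r, ∫ s, (t - s) ^ (β - 1) * k s r * g r ∂μ ∂μ
      = Real.Gamma α * Real.Gamma β * ∫ r in (0 : ℝ)..t, g r := by
    -- The endpoint `r = t` is dropped because the Beta identity needs `r < t`.
    rw [intervalIntegral.integral_of_le ht, ← integral_const_mul, integral_Ioc_eq_integral_Ioo,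
      integral_Ioc_eq_integral_Ioo]
    refine setIntegral_congr_fun measurableSet_Ioo fun r hr => ?_
    rw [integral_mul_const]
    congr 1
    rw [← integral_rlKernel_mul_rlKernel hα hβ hαβ hr.2, intervalIntegral.integral_of_le hr.2.le]
    have h1 : (fun s => (t - s) ^ (β - 1) * k s r)
        = (Ioi r).indicator fun s => (t - s) ^ (β - 1) * (s - r) ^ (α - 1) := by
      ext s
      by_cases h : r < s <;> simp [hk, h]
    rw [h1, integral_indicator measurableSet_Ioi, hμ, Measure.restrict_restrict measurableSet_Ioi]
    congr 2
    ext s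
    simp only [mem_inter_iff, mem_Ioi, mem_Ioc]
    exact ⟨fun h => ⟨h.1, h.2.2⟩, fun h => ⟨h.1, hr.1.trans h.1, h.2⟩⟩
  rw [hleft, hright] at hswap
  have hΓα := (Real.Gamma_pos_of_pos hα).ne'
  have hΓβ := (Real.Gamma_pos_of_pos hβ).ne'
  have hassoc : ∀ s, (t - s) ^ (β - 1) * (1 / Real.Gamma α *
        ∫ r in (0 : ℝ)..s, (s - r) ^ (α - 1) * g r)
      = 1 / Real.Gamma α * ((t - s) ^ (β - 1) *
        ∫ r in (0 : ℝ)..s, (s - r) ^ (α - 1) * g r) := fun s => mul_left_comm _ _ _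
  simp only [rlIntegral, hassoc]
  rw [intervalIntegral.integral_const_mul, hswap]
  field_simp

/-! ### The Volterra equation in the weighted norm -/

theorem hasDerivWithinAt_integral_Icc {B t : ℝ} {g : ℝ → ℝ} (hg : ContinuousOn g (Icc 0 B))
    (ht : t ∈ Icc 0 B) :
    HasDerivWithinAt (fun u => ∫ s in (0 : ℝ)..u, g s) (g t) (Icc 0 B) t := by
  obtain ⟨G, hG, -, hgG⟩ := exists_continuous_bounded_eqOn_Icc (ht.1.trans ht.2) hg
  have heq : EqOn (fun u => ∫ s in (0 : ℝ)..u, g s) (fun u => ∫ s in (0 : ℝ)..u, G s)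
      (Icc 0 B) := by
    intro u hu
    refine intervalIntegral.integral_congr fun s hs => ?_
    rw [uIcc_of_le hu.1] at hs
    exact hgG ⟨hs.1, hs.2.trans hu.2⟩
  rw [hgG ht]
  exact (hG.integral_hasStrictDerivAt 0 t).hasDerivAt.hasDerivWithinAt.congr heq (heq ht)

theorem abs_rlIntegral_le_of_abs_le_exp {α l t D : ℝ} (hα : 0 < α) (hl : 0 < l) (ht : 0 ≤ t)
    (hD : 0 ≤ D) {g : ℝ → ℝ} (hg : ∀ s ∈ Icc 0 t, |g s| ≤ D * Real.exp (l * s)) :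
    |rlIntegral α 0 g t| ≤ D * (1 / l) ^ α * Real.exp (l * t) := by
  refine (abs_rlIntegral_le hα ht (by fun_prop) hg).trans ?_
  rw [rlIntegral_const_mul, mul_assoc]
  exact mul_le_mul_of_nonneg_left (rlIntegral_exp_le hα hl ht) hD

theorem exists_pos_mul_rpow_le_half {α : ℝ} (hα : 0 < α) (m : ℝ) :
    ∃ l : ℝ, 0 < l ∧ |m| * (1 / l) ^ α ≤ 1 / 2 := by
  have hm : 0 < 2 * (|m| + 1) := by positivity
  -- Chosen so that `l^α = 2(|m| + 1)`; the `+ 1` covers `m = 0`.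
  refine ⟨(2 * (|m| + 1)) ^ (1 / α), by positivity, ?_⟩
  rw [Real.div_rpow zero_le_one (by positivity), Real.one_rpow, ← Real.rpow_mul hm.le,
    one_div_mul_cancel hα.ne', Real.rpow_one, mul_one_div, div_le_div_iff₀ hm two_pos]
  linarith

/-- At a maximum point of `|D| e^(-lt)`, the equation bounds the maximum `C` by `C / 2`. -/
theorem eqOn_zero_of_eq_mul_rlIntegral {α m B : ℝ} (hα : 0 < α) {D : ℝ → ℝ}
    (hD : ContinuousOn D (Icc 0 B)) (h : ∀ t ∈ Icc 0 B, D t = m * rlIntegral α 0 D t) :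
    ∀ t ∈ Icc 0 B, D t = 0 := by
  intro t₁ ht₁
  obtain ⟨l, hl, hml⟩ := exists_pos_mul_rpow_le_half hα m
  have hc : ContinuousOn (fun t => |D t| * Real.exp (-(l * t))) (Icc 0 B) :=
    hD.abs.mul (by fun_prop)
  obtain ⟨t₀, ht₀, hmax⟩ := isCompact_Icc.exists_isMaxOn ⟨t₁, ht₁⟩ hc
  set C := |D t₀| * Real.exp (-(l * t₀)) with hC
  have hC0 : 0 ≤ C := by positivity
  have hbd : ∀ t ∈ Icc 0 B, |D t| ≤ C * Real.exp (l * t) := by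
    intro t ht
    have := mul_le_mul_of_nonneg_right (hmax ht) (Real.exp_pos (l * t)).le
    simp only [mul_assoc] at this
    rwa [← Real.exp_add, neg_add_cancel, Real.exp_zero, mul_one, ← mul_assoc, ← hC] at this
  have h1 := abs_rlIntegral_le_of_abs_le_exp hα hl ht₀.1 hC0
    (fun s hs => hbd s ⟨hs.1, hs.2.trans ht₀.2⟩)
  have h2 : |D t₀| ≤ C / 2 * Real.exp (l * t₀) := by
    rw [h t₀ ht₀, abs_mul]
    calc |m| * |rlIntegral α 0 D t₀| ≤ |m| * (C * (1 / l) ^ α * Real.exp (l * t₀)) := by gcongr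
      _ = |m| * (1 / l) ^ α * (C * Real.exp (l * t₀)) := by ring
      _ ≤ 1 / 2 * (C * Real.exp (l * t₀)) := by gcongr
      _ = C / 2 * Real.exp (l * t₀) := by ring
  have h3 : C ≤ C / 2 := by
    calc C ≤ C / 2 * Real.exp (l * t₀) * Real.exp (-(l * t₀)) := by rw [hC]; gcongr
      _ = C / 2 := by rw [mul_assoc, ← Real.exp_add, add_neg_cancel, Real.exp_zero, mul_one]
  have h4 : C = 0 := by linarith
  have := hbd t₁ ht₁
  rw [h4, zero_mul] at this
  exact abs_nonpos_iff.1 this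

theorem exists_volterra_solution {α m y₀ K B : ℝ} (hα : 0 < α) (hB : 0 ≤ B) (hK : 0 ≤ K)
    {f : ℝ → ℝ} (hf : ContinuousOn f (Icc 0 B))
    (hbd : ∀ y : ℝ → ℝ, (∀ t ∈ Icc 0 B, |y t - y₀| ≤ K) →
      ∀ t ∈ Icc 0 B, |rlIntegral α 0 (fun s => m * y s + f s) t| ≤ K) :
    ∃ y : ℝ → ℝ, ContinuousOn y (Icc 0 B) ∧ (∀ t ∈ Icc 0 B, |y t - y₀| ≤ K) ∧
      ∀ t ∈ Icc 0 B, y t = y₀ + rlIntegral α 0 (fun s => m * y s + f s) t := by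
  obtain ⟨l, hl, hml⟩ := exists_pos_mul_rpow_le_half hα m
  -- The unknown is `v = e^(-ls) y`: the sup metric on `v` is the weighted metric on `y = Y v`.
  let Y : C(Icc 0 B, ℝ) → ℝ → ℝ := fun v s => Real.exp (l * s) * IccExtend hB v s
  have hYc : ∀ v, Continuous (Y v) := fun v =>
    Continuous.mul (by fun_prop) v.continuous.Icc_extend'
  have hYv : ∀ v (t : Icc 0 B), Y v t = Real.exp (l * t) * v t := fun v t => by
    simp only [Y, IccExtend_val]
  have hzc : ∀ v, ContinuousOn (fun s => m * Y v s + f s) (Icc 0 B) := fun v =>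
    ((hYc v).const_mul m).continuousOn.add hf
  let T : C(Icc 0 B, ℝ) → C(Icc 0 B, ℝ) := fun v =>
    ⟨fun t => Real.exp (-(l * t)) * (y₀ + rlIntegral α 0 (fun s => m * Y v s + f s) t),
      Continuous.mul (by fun_prop) (continuous_const.add
        (continuousOn_iff_continuous_domRestrict.1 (continuousOn_rlIntegral hα hB (hzc v))))⟩
  have hTY : ∀ v, ∀ t ∈ Icc 0 B,
      Y (T v) t = y₀ + rlIntegral α 0 (fun s => m * Y v s + f s) t := by
    intro v t ht
    rw [hYv (T v) ⟨t, ht⟩]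
    change Real.exp (l * t) * (Real.exp (-(l * t)) * _) = _
    rw [← mul_assoc, ← Real.exp_add, add_neg_cancel, Real.exp_zero, one_mul]
  have hT : ContractingWith (1 / 2) T := by
    refine ⟨by norm_num, LipschitzWith.of_dist_le_mul fun v w => ?_⟩
    rw [ContinuousMap.dist_le (by positivity)]
    intro t
    have ht := t.2
    have h0 : ∀ s ∈ Icc 0 (t : ℝ), |(m * Y v s + f s) - (m * Y w s + f s)|
        ≤ |m| * dist v w * Real.exp (l * s) := by
      intro s hs
      have hs' : s ∈ Icc 0 B := ⟨hs.1, hs.2.trans ht.2⟩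
      have h1 : |v ⟨s, hs'⟩ - w ⟨s, hs'⟩| ≤ dist v w := by
        rw [← Real.dist_eq]
        exact ContinuousMap.dist_apply_le_dist _
      have h2 : (m * Y v s + f s) - (m * Y w s + f s)
          = m * (Real.exp (l * s) * (v ⟨s, hs'⟩ - w ⟨s, hs'⟩)) := by
        rw [hYv v ⟨s, hs'⟩, hYv w ⟨s, hs'⟩]
        ring
      rw [h2, abs_mul, abs_mul, abs_of_pos (Real.exp_pos _)]
      calc |m| * (Real.exp (l * s) * |v ⟨s, hs'⟩ - w ⟨s, hs'⟩|)
          ≤ |m| * (Real.exp (l * s) * dist v w) := by gcongr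
        _ = |m| * dist v w * Real.exp (l * s) := by ring
    have h3 := abs_rlIntegral_le_of_abs_le_exp hα hl ht.1 (by positivity) h0
    rw [rlIntegral_sub hα ht.1 ((hzc v).mono (Icc_subset_Icc_right ht.2))
      ((hzc w).mono (Icc_subset_Icc_right ht.2))] at h3
    rw [Real.dist_eq]
    change |Real.exp (-(l * t)) * _ - Real.exp (-(l * t)) * _| ≤ _
    rw [← mul_sub, add_sub_add_left_eq_sub, abs_mul, abs_of_pos (Real.exp_pos _)]
    calc _ ≤ Real.exp (-(l * t)) * (|m| * dist v w * (1 / l) ^ α * Real.exp (l * t)) := by gcongr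
      _ = |m| * (1 / l) ^ α * dist v w * (Real.exp (-(l * t)) * Real.exp (l * t)) := by ring
      _ = |m| * (1 / l) ^ α * dist v w := by
        rw [← Real.exp_add, neg_add_cancel, Real.exp_zero, mul_one]
      _ ≤ _ := by
        push_cast
        gcongr
  let S : Set C(Icc 0 B, ℝ) := {v | ∀ t : Icc 0 B, |Y v t - y₀| ≤ K}
  have hSc : IsClosed S := by
    have : S = ⋂ t : Icc 0 B, {v | |Real.exp (l * t) * v t - y₀| ≤ K} := by
      ext v
      simp [S, hYv]
    rw [this]
    exact isClosed_iInter fun t => isClosed_le (by fun_prop) continuous_const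
  have hST : MapsTo T S S := by
    intro v hv t
    rw [hTY v t t.2, add_sub_cancel_left]
    exact hbd (Y v) (fun s hs => hv ⟨s, hs⟩) t t.2
  let v₀ : C(Icc 0 B, ℝ) := ⟨fun t => Real.exp (-(l * t)) * y₀, by fun_prop⟩
  have hv₀ : v₀ ∈ S := by
    intro t
    rw [hYv]
    change |Real.exp (l * t) * (Real.exp (-(l * t)) * y₀) - y₀| ≤ K
    rw [← mul_assoc, ← Real.exp_add, add_neg_cancel, Real.exp_zero, one_mul, sub_self, abs_zero]
    exact hK
  obtain ⟨v, hvS, hvT, -⟩ := hT.restrict hST |>.exists_fixedPoint' hSc.isComplete hST hv₀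
    (edist_ne_top _ _)
  refine ⟨Y v, (hYc v).continuousOn, fun t ht => hvS ⟨t, ht⟩, fun t ht => ?_⟩
  have := hTY v t ht
  rwa [hvT.eq] at this

/-! ### The Caputo problem: existence and uniqueness -/

theorem isCaputoSolution_of_volterra {α m y₀ B : ℝ} (hα₀ : 0 < α) (hα₁ : α < 1) (hB : 0 ≤ B)
    {f y : ℝ → ℝ} (hf : ContinuousOn f (Icc 0 B)) (hy : ContinuousOn y (Icc 0 B))
    (h : ∀ t ∈ Icc 0 B, y t = y₀ + rlIntegral α 0 (fun s => m * y s + f s) t) :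
    IsCaputoSolution α m f y₀ B y := by
  have h0 : y 0 = y₀ := by
    rw [h 0 ⟨le_rfl, hB⟩, rlIntegral_zero_right, add_zero]
  have hz : ContinuousOn (fun s => m * y s + f s) (Icc 0 B) := (hy.const_smul m).add hf
  refine ⟨hy, h0, fun t ht => ?_⟩
  have heq : EqOn (rlIntegral (1 - α) 0 fun s => y s - y 0)
      (fun u => ∫ s in (0 : ℝ)..u, (m * y s + f s)) (Icc 0 B) := by
    intro u hu
    beta_reduce
    rw [← rlIntegral_rlIntegral hα₀ (sub_pos.2 hα₁) (add_sub_cancel α 1) hu.1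
      (hz.mono (Icc_subset_Icc_right hu.2))]
    refine rlIntegral_congr hu.1 fun s hs => ?_
    rw [h s ⟨hs.1, hs.2.trans hu.2⟩, h0, add_sub_cancel_left]
  exact (hasDerivWithinAt_integral_Icc hz ht).congr heq (heq ht)

/-- Working with the primitive `D` of the difference avoids inverting the Caputo derivative. -/
theorem IsCaputoSolution.eqOn {α m y₀ B : ℝ} (hα₀ : 0 < α) (hα₁ : α < 1) (hB : 0 < B)
    {f w y : ℝ → ℝ} (hw : IsCaputoSolution α m f y₀ B w) (hy : IsCaputoSolution α m f y₀ B y) :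
    EqOn w y (Icc 0 B) := by
  have hβ : 0 < 1 - α := sub_pos.2 hα₁
  set d : ℝ → ℝ := fun s => w s - y s with hd
  have hdc : ContinuousOn d (Icc 0 B) := hw.continuousOn.sub hy.continuousOn
  set D : ℝ → ℝ := fun t => ∫ s in (0 : ℝ)..t, d s with hD
  have hDd : ∀ t ∈ Icc 0 B, HasDerivWithinAt D (d t) (Icc 0 B) t := fun t ht =>
    hasDerivWithinAt_integral_Icc hdc ht
  have hDc : ContinuousOn D (Icc 0 B) := fun t ht => (hDd t ht).continuousWithinAt
  set Φ : ℝ → ℝ := rlIntegral (1 - α) 0 d with hΦ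
  have hΦd : ∀ t ∈ Icc 0 B, HasDerivWithinAt Φ (m * d t) (Icc 0 B) t := by
    intro t ht
    have h1 := (hw.equation t ht).sub (hy.equation t ht)
    have heq : EqOn Φ (rlIntegral (1 - α) 0 (fun s => w s - w 0) -
        rlIntegral (1 - α) 0 fun s => y s - y 0) (Icc 0 B) := by
      intro u hu
      have hsub : Icc 0 u ⊆ Icc 0 B := Icc_subset_Icc_right hu.2
      rw [Pi.sub_apply, ← rlIntegral_sub hβ hu.1 (g := fun s => w s - w 0)
        (h := fun s => y s - y 0) ((hw.continuousOn.mono hsub).sub continuousOn_const)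
        ((hy.continuousOn.mono hsub).sub continuousOn_const)]
      refine rlIntegral_congr hu.1 fun s _ => ?_
      simp only [hd, hw.initial, hy.initial]
      ring
    have h2 := h1.congr heq (heq ht)
    rwa [show m * w t + f t - (m * y t + f t) = m * d t by simp only [hd]; ring] at h2
  have hΦD : ∀ t ∈ Icc 0 B, Φ t = m * D t := by
    intro t ht
    have hdiff : ∀ s ∈ Icc 0 B,
        HasDerivWithinAt (fun u => Φ u - m * D u) 0 (Icc 0 B) s := by
      intro s hs
      have h1 := (hΦd s hs).sub ((hDd s hs).const_mul m)
      rwa [sub_self] at h1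
    have hconst := constant_of_derivWithin_zero
      (fun s hs => (hdiff s hs).differentiableWithinAt)
      (fun s hs => (hdiff s (Ico_subset_Icc_self hs)).derivWithin
        (uniqueDiffOn_Icc hB s (Ico_subset_Icc_self hs))) t ht
    simp only [hΦ, hD, rlIntegral_zero_right, intervalIntegral.integral_same, mul_zero,
      sub_zero] at hconst
    exact sub_eq_zero.1 hconst
  -- Apply `J^α` to `Φ = m D`, using `J^α Φ = J^α J^(1-α) d = D`.
  have hDeq : ∀ t ∈ Icc 0 B, D t = m * rlIntegral α 0 D t := by
    intro t ht
    have hsub : Icc 0 t ⊆ Icc 0 B := Icc_subset_Icc_right ht.2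
    rw [← rlIntegral_const_mul, ← rlIntegral_congr ht.1 (fun s hs => hΦD s (hsub hs)), hΦ,
      rlIntegral_rlIntegral hβ hα₀ (sub_add_cancel 1 α) ht.1 (hdc.mono hsub)]
  have hD0 := eqOn_zero_of_eq_mul_rlIntegral hα₀ hDc hDeq
  intro t ht
  have h1 : HasDerivWithinAt D 0 (Icc 0 B) t :=
    (hasDerivWithinAt_const t (Icc 0 B) (0 : ℝ)).congr hD0 (hD0 t ht)
  have hu := uniqueDiffOn_Icc hB t ht
  exact sub_eq_zero.1 (((hDd t ht).derivWithin hu).symm.trans (h1.derivWithin hu))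

/-! ### The box, the supremum `M` and the time `B` -/

theorem abs_le_rhsSup {m b K y₀ : ℝ} {f : ℝ → ℝ}
    (hz : ContinuousOn (fun p : ℝ × ℝ => m * p.2 + f p.1) (solutionBox b K y₀))
    {p : ℝ × ℝ} (hp : p ∈ solutionBox b K y₀) :
    |m * p.2 + f p.1| ≤ rhsSup m f b K y₀ := by
  have hbox : solutionBox b K y₀ = Icc 0 b ×ˢ Metric.closedBall y₀ K := by
    ext q
    simp [solutionBox, Real.dist_eq]
  have hcomp : IsCompact (solutionBox b K y₀) := by
    rw [hbox]
    exact isCompact_Icc.prod (isCompact_closedBall y₀ K)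
  exact le_csSup (hcomp.image_of_continuousOn hz.abs).bddAbove (mem_image_of_mem _ hp)

theorem existenceTime_le {α m b K y₀ : ℝ} {f : ℝ → ℝ} : existenceTime α m f b K y₀ ≤ b := by
  unfold existenceTime
  split_ifs
  · exact le_rfl
  · exact min_le_left _ _

theorem mainTheorem2 (α m y₀ K b : ℝ) (f : ℝ → ℝ)
    (hα₀ : 0 < α) (hα₁ : α < 1) (hK : 0 < K) (hb : 0 < b)
    (hz : ContinuousOn (fun p : ℝ × ℝ => m * p.2 + f p.1) (solutionBox b K y₀)) :
    ∃ y : ℝ → ℝ,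
      IsCaputoSolution α m f y₀ (existenceTime α m f b K y₀) y ∧
      (∀ t ∈ Set.Icc 0 (existenceTime α m f b K y₀), |y t - y₀| ≤ K) ∧
      ∀ w : ℝ → ℝ, IsCaputoSolution α m f y₀ (existenceTime α m f b K y₀) w →
        Set.EqOn w y (Set.Icc 0 (existenceTime α m f b K y₀)) := by
  have hΓ : 0 < Real.Gamma (α + 1) := Real.Gamma_pos_of_pos (by linarith)
  set M := rhsSup m f b K y₀ with hM
  set B := existenceTime α m f b K y₀ with hBdef
  have hM0 : 0 ≤ M := (abs_nonneg _).trans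
    (abs_le_rhsSup (p := (0, y₀)) hz ⟨⟨le_rfl, hb.le⟩, by simpa using hK.le⟩)
  have hBb : B ≤ b := existenceTime_le
  have hB : 0 < B ∧ ∀ t ∈ Icc 0 B, M * (t ^ α / Real.Gamma (α + 1)) ≤ K := by
    by_cases h : M = 0
    · rw [hBdef, existenceTime, if_pos h, h]
      exact ⟨hb, fun t _ => by simpa using hK.le⟩
    · have hMpos : 0 < M := lt_of_le_of_ne hM0 (Ne.symm h)
      rw [hBdef, existenceTime, if_neg h, ← hM]
      have hq : 0 < K * Real.Gamma (α + 1) / M := by positivity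
      refine ⟨lt_min hb (Real.rpow_pos_of_pos hq _), fun t ht => ?_⟩
      have h1 := Real.rpow_le_rpow ht.1 (ht.2.trans (min_le_right _ _)) hα₀.le
      rw [← Real.rpow_mul hq.le, one_div_mul_cancel hα₀.ne', Real.rpow_one, le_div_iff₀ hMpos]
        at h1
      rw [← mul_div_assoc, div_le_iff₀ hΓ]
      linarith
  obtain ⟨hB0, hBK⟩ := hB
  -- Restrict `z` to the segment `y = y₀` and subtract `m y₀`.
  have hfb : ContinuousOn f (Icc 0 b) := by
    have h1 : ContinuousOn (fun t : ℝ => m * y₀ + f t) (Icc 0 b) :=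
      hz.comp (f := fun t : ℝ => (t, y₀)) (by fun_prop) fun t ht => ⟨ht, by simpa using hK.le⟩
    exact (h1.sub (continuousOn_const (c := m * y₀))).congr fun t _ => by
      simp only [Pi.sub_apply, add_sub_cancel_left]
  have hf : ContinuousOn f (Icc 0 B) := hfb.mono (Icc_subset_Icc_right hBb)
  obtain ⟨y, hyc, hyK, hy⟩ := exists_volterra_solution (m := m) (y₀ := y₀) hα₀ hB0.le hK.le hf
    fun y hy t ht => by
      refine (abs_rlIntegral_le hα₀ ht.1 continuousOn_const (h := fun _ => M) fun s hs =>
        abs_le_rhsSup (p := (s, y s)) hz ?_).trans ?_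
      · have hs' : s ∈ Icc 0 B := ⟨hs.1, hs.2.trans ht.2⟩
        exact ⟨⟨hs.1, hs'.2.trans hBb⟩, hy s hs'⟩
      · rw [rlIntegral_const hα₀]
        exact hBK t ht
  have hsol := isCaputoSolution_of_volterra hα₀ hα₁ hB0.le hf hyc hy
  exact ⟨y, hsol, hyK, fun w hw => hw.eqOn hα₀ hα₁ hB0 hsol⟩
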